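/- Call a function $f:[0,\infty)\to\mathbb R$ log-concave if $f\ge 0$ and $f(\lambda x+(1-\lambda)y)\ge f(x)^{\lambda}f(y)^{1-\lambda}$ for all $x,y\ge 0$, $0<\lambda<1$. A measure on $[0,\infty)$ is called log-concave if it is either of the form $c\,\delta_{x_0}$ with $c\ge 0$, $x_0\ge 0$, or has a density (with respect to Lebesgue measure on $[0,\infty)$) that is a log-concave function. For a finite Borel measure $\mu$ on $[0,\infty)$ put $$F_\mu(t)=\int_0^\infty e^{-itx}\,d\mu(x)\quad(t\in\mathbb R),\qquad a_t(j)=\int_0^\infty \frac{x^j}{j!}e^{-tx}\,d\mu(x)\quad(t>0,\ j\ge 0).$$ Proposition. Let $\mu$ be a finite, log-concave measure on $[0,\infty)$. Then $F_\mu$ is $C^\infty$-smooth on $\mathbb R$, and for any non-negative integers $k\le\ell\le m\le n$ with $k+n=\ell+m$ there exists a finite, non-negative Borel measure $\nu=\nu_{k,\ell,m,n}$ on $[0,\infty)$ such that for all $t>0$, $$\int_0^\infty e^{-tx}\,d\nu(x)=a_t(\ell)a_t(m)-a_t(k)a_t(n);$$ this measure is unique (it is called the Berwald–Borell transform of $\mu$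 with parameters $(k,\ell,m,n)$), and it satisfies, for all $t\in\mathbb R$, $$\frac{F_\mu^{(\ell)}(t)}{\ell!}\frac{F_\mu^{(m)}(t)}{m!}-\frac{F_\mu^{(k)}(t)}{k!}\frac{F_\mu^{(n)}(t)}{n!}=(-i)^{\ell+m}F_\nu(t).$$ -/

import Mathlib

open MeasureTheory

/-- A function `f` is log-concave on a set `K ⊆ ℝ` (in applications a convex set): it is
non-negative on `K` and `f (s x + (1 - s) y) ≥ f x ^ s * f y ^ (1 - s)` for `x, y ∈ K`, `0 < s < 1`. -/
def LogConcaveFunOn (K : Set ℝ) (f : ℝ → ℝ) : Prop :=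
  (∀ x ∈ K, 0 ≤ f x) ∧
  ∀ x ∈ K, ∀ y ∈ K, ∀ s : ℝ, 0 < s → s < 1 →
    f x ^ s * f y ^ (1 - s) ≤ f (s * x + (1 - s) * y)

/-- Log-concave measures on `[0, ∞)`, regarded as Borel measures on `ℝ` that do not charge the
negative half-line: either a non-negative multiple of a delta measure at a point of `[0, ∞)`, or a
measure with a log-concave density on `[0, ∞)`. The values of `f` outside `[0, ∞)` play no role. -/
def IsLogConcaveMeasure (μ : Measure ℝ) : Prop :=
  (∃ (c : NNReal) (x₀ : ℝ), 0 ≤ x₀ ∧ μ = c • Measure.dirac x₀) ∨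
  ∃ f : ℝ → ℝ, LogConcaveFunOn (Set.Ici 0) f ∧
    μ = (volume.restrict (Set.Ici 0)).withDensity (fun x => ENNReal.ofReal (f x))

/-- The coefficient `a_t(j) = ∫ (x ^ j / j!) e^{-t x} dμ(x)`, for `μ` living on `[0, ∞)`. -/
noncomputable def taylorCoeff (μ : Measure ℝ) (t : ℝ) (j : ℕ) : ℝ :=
  ∫ x, x ^ j / (j.factorial : ℝ) * Real.exp (-(t * x)) ∂μ

/-- `ν` is a Berwald-Borell transform of `μ` with parameters `(k, l, m, n)`: a finite measure
on `[0, ∞)` whose Laplace transform at every `t > 0` is `a_t(l) a_t(m) - a_t(k) a_t(n)`. -/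
structure IsBerwaldBorellTransform (μ : Measure ℝ) (k l m n : ℕ) (ν : Measure ℝ) : Prop where
  finite : IsFiniteMeasure ν
  neg_null : ν (Set.Iio 0) = 0
  laplace : ∀ t : ℝ, 0 < t →
    ∫ x, Real.exp (-(t * x)) ∂ν =
      taylorCoeff μ t l * taylorCoeff μ t m - taylorCoeff μ t k * taylorCoeff μ t n

/-- The Fourier transform `F_μ(t) = ∫ e^{-i t x} dμ(x)`, for `μ` living on `[0, ∞)`. -/
noncomputable def fourierMeasure (μ : Measure ℝ) (t : ℝ) : ℂ :=
  ∫ x, Complex.exp (-(Complex.I * (t : ℂ) * (x : ℂ))) ∂μ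

/-!
Since the Laplace transform turns convolutions into products, the Berwald–Borell transform can only
be `ν = M l ∗ M m - M k ∗ M n`, where `M j` is the measure `x ^ j / j! dμ(x)`, and the point is
that this difference is non-negative. Moving one unit of exponent at a time, it is enough to show
`M i ∗ M (j + 1) ≤ M (i + 1) ∗ M j` for `i ≤ j`. If `μ` has a log-concave density `f`, then the
superlevel sets of `x ↦ f x * f (s - x)` are intervals symmetric about `s / 2`, so by the layer
cake formula the densities at `s` only have to be compared after replacing `f x * f (s - x)` by the
indicator function of an interval `[c, s - c]`. There the two integrands differ by the derivative
of `x ^ (i + 1) / (i + 1)! * (s - x) ^ (j + 1) / (j + 1)!`, and the boundary terms have the right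
sign.

An integrable log-concave function decays exponentially, so all moments of `μ` are finite. This
makes the Fourier transform smooth, and testing `ν` against `x ↦ exp (-i t x)` instead of
`x ↦ exp (-t x)` gives the Fourier identity. For uniqueness, the Laplace transform of a finite measure on the
half-line is analytic in the open half-plane and has the characteristic function as its boundary
value.
-/

open Asymptotics Filter ProbabilityTheory Set
open scoped ENNReal NNReal Topology

/-! ### Log-concave functions and measures -/

theorem eqOn_zero_of_monotoneOn_of_integrableOn_Ici {f : ℝ → ℝ} {a : ℝ}
    (hmono : MonotoneOn f (Ici a)) (hnonneg : ∀ x ∈ Ici a, 0 ≤ f x)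
    (hint : IntegrableOn f (Ici a)) : EqOn f 0 (Ici a) := by
  intro x hx
  have hconst : IntegrableOn (fun _ => f x) (Ici x) := by
    refine Integrable.mono' (hint.mono_set (Ici_subset_Ici.2 hx)) (by fun_prop) ?_
    filter_upwards [ae_restrict_mem measurableSet_Ici] with y hxy
    rw [Real.norm_of_nonneg (hnonneg x hx)]
    exact hmono hx (mem_Ici.2 (hx.trans hxy)) hxy
  simpa [integrableOn_const_iff] using hconst

namespace LogConcaveFunOn

variable {f : ℝ → ℝ} {K : Set ℝ}

theorem mono {L : Set ℝ} (hf : LogConcaveFunOn L f) (hKL : K ⊆ L) : LogConcaveFunOn K f :=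
  ⟨fun x hx => hf.1 x (hKL hx), fun x hx y hy => hf.2 x (hKL hx) y (hKL hy)⟩

theorem rpow_mul_rpow_le (hf : LogConcaveFunOn K f) {x y a b : ℝ} (hx : x ∈ K) (hy : y ∈ K)
    (ha : 0 ≤ a) (hb : 0 ≤ b) (hab : a + b = 1) : f x ^ a * f y ^ b ≤ f (a * x + b * y) := by
  rcases ha.eq_or_lt with rfl | ha
  · obtain rfl : b = 1 := by linarith
    simp
  rcases hb.eq_or_lt with rfl | hb
  · obtain rfl : a = 1 := by linarith
    simp
  obtain rfl : b = 1 - a := by linarith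
  exact hf.2 x hx y hy a ha (by linarith)

theorem mul_le_mul_of_mem_Icc (hf : LogConcaveFunOn K f) {x u v : ℝ} (hu : u ∈ K) (hv : v ∈ K)
    (hx : x ∈ Icc u v) : f u * f v ≤ f x * f (u + v - x) := by
  rw [← segment_eq_Icc (hx.1.trans hx.2)] at hx
  obtain ⟨a, b, ha, hb, hab, rfl⟩ := hx
  have hfu := hf.1 u hu
  have hfv := hf.1 v hv
  have hreflect : u + v - (a • u + b • v) = a * v + b * u := by
    simp only [smul_eq_mul]
    linear_combination -(u + v) * hab
  calc f u * f v = f u ^ (a + b) * f v ^ (a + b) := by rw [hab, Real.rpow_one, Real.rpow_one]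
    _ = (f u ^ a * f v ^ b) * (f v ^ a * f u ^ b) := by
        rw [Real.rpow_add_of_nonneg hfu ha hb, Real.rpow_add_of_nonneg hfv ha hb]
        ring
    _ ≤ f (a * u + b * v) * f (a * v + b * u) :=
        mul_le_mul (hf.rpow_mul_rpow_le hu hv ha hb hab) (hf.rpow_mul_rpow_le hv hu ha hb hab)
          (by positivity) ((by positivity : 0 ≤ f u ^ a * f v ^ b).trans
            (hf.rpow_mul_rpow_le hu hv ha hb hab))
    _ = f (a • u + b • v) * f (u + v - (a • u + b • v)) := by rw [hreflect]; rfl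

theorem quasiconcaveOn (hf : LogConcaveFunOn K f) (hK : Convex ℝ K) : QuasiconcaveOn ℝ K f := by
  refine quasiconcaveOn_iff_min_le.2 ⟨hK, fun x hx y hy a b ha hb hab => ?_⟩
  have hmin : 0 ≤ min (f x) (f y) := le_min (hf.1 x hx) (hf.1 y hy)
  calc min (f x) (f y) = min (f x) (f y) ^ a * min (f x) (f y) ^ b := by
        rw [← Real.rpow_add_of_nonneg hmin ha hb, hab, Real.rpow_one]
    _ ≤ f x ^ a * f y ^ b := by
        gcongr
        exacts [Real.rpow_nonneg (hf.1 x hx) a, min_le_left _ _, min_le_right _ _]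
    _ ≤ f (a • x + b • y) := hf.rpow_mul_rpow_le hx hy ha hb hab

theorem indicator (hf : LogConcaveFunOn K f) (hK : Convex ℝ K) :
    LogConcaveFunOn univ (K.indicator f) := by
  have hnonneg : ∀ x, 0 ≤ K.indicator f x := indicator_nonneg hf.1
  refine ⟨fun x _ => hnonneg x, fun x _ y _ s hs0 hs1 => ?_⟩
  by_cases hx : x ∈ K
  · by_cases hy : y ∈ K
    · have hxy : s * x + (1 - s) * y ∈ K := hK hx hy hs0.le (by linarith) (by ring)
      simpa only [indicator_of_mem, hx, hy, hxy] using hf.2 x hx y hy s hs0 hs1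
    · rw [indicator_of_notMem hy, Real.zero_rpow (by linarith), mul_zero]
      exact hnonneg _
  · rw [indicator_of_notMem hx, Real.zero_rpow hs0.ne', zero_mul]
    exact hnonneg _

theorem measurable (hf : LogConcaveFunOn univ f) : Measurable f := by
  refine measurable_of_Ici fun c => ?_
  have hconvex : Convex ℝ (f ⁻¹' Ici c) := by
    simpa only [mem_univ, true_and, preimage, mem_Ici] using hf.quasiconcaveOn convex_univ c
  exact hconvex.ordConnected.measurableSet

theorem le_rpow_mul_of_le_mul (hf : LogConcaveFunOn K f) {x y z q : ℝ} (hx : x ∈ K) (hz : z ∈ K)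
    (hxy : x < y) (hyz : y < z) (hfx : 0 < f x) (hq : 0 ≤ q) (hle : f y ≤ q * f x) :
    f z ≤ q ^ ((z - x) / (y - x)) * f x := by
  have hyx : 0 < y - x := sub_pos.2 hxy
  have hzx : 0 < z - x := sub_pos.2 (hxy.trans hyz)
  have hfz : 0 ≤ f z := hf.1 z hz
  set r := (y - x) / (z - x) with hr
  have hr0 : 0 < r := div_pos hyx hzx
  have hr1 : r < 1 := (div_lt_one hzx).2 (by linarith)
  have hy : r * z + (1 - r) * x = y := by rw [hr]; field_simp; ring
  have hpow : (f z / f x) ^ r ≤ q := by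
    rw [Real.div_rpow hfz hfx.le, div_le_iff₀ (by positivity)]
    refine le_of_mul_le_mul_right ?_ (Real.rpow_pos_of_pos hfx (1 - r))
    calc f z ^ r * f x ^ (1 - r) ≤ q * f x :=
          (hf.2 z hz x hx r hr0 hr1).trans (hy.symm ▸ hle)
      _ = q * f x ^ r * f x ^ (1 - r) := by
          rw [mul_assoc, ← Real.rpow_add hfx, add_sub_cancel, Real.rpow_one]
  rw [← div_le_iff₀ hfx, ← inv_div (y - x), ← hr]
  exact (Real.le_rpow_inv_iff_of_pos (by positivity) hq hr0).2 hpow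

theorem exists_isBigO_exp_neg {a : ℝ} (hf : LogConcaveFunOn (Ici a) f)
    (hint : IntegrableOn f (Ici a)) : ∃ c > 0, f =O[atTop] fun x => Real.exp (-c * x) := by
  -- Either `f` never decreases and then vanishes, or it decreases by a factor `q < 1` over some
  -- interval and then, by log-concavity, at least at this rate ever after.
  by_cases hmono : MonotoneOn f (Ici a)
  · refine ⟨1, one_pos, IsBigO.of_bound 0 ?_⟩
    filter_upwards [eventually_ge_atTop a] with x hx
    simp [eqOn_zero_of_monotoneOn_of_integrableOn_Ici hmono hf.1 hint hx]
  simp only [MonotoneOn, not_forall, not_le] at hmono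
  obtain ⟨x, hx, y, hy, hxy, hlt⟩ := hmono
  have hxy : x < y := hxy.lt_of_ne (by rintro rfl; exact hlt.false)
  have hfx : 0 < f x := (hf.1 y hy).trans_lt hlt
  obtain ⟨q, hq, hq1⟩ := exists_between ((div_lt_one hfx).2 hlt)
  have hq0 : 0 < q := (div_nonneg (hf.1 y hy) hfx.le).trans_lt hq
  set c := -Real.log q / (y - x) with hc
  refine ⟨c, div_pos (neg_pos.2 (Real.log_neg hq0 hq1)) (sub_pos.2 hxy),
    IsBigO.of_bound (Real.exp (c * x) * f x) ?_⟩
  filter_upwards [eventually_gt_atTop y] with z hyz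
  have hz : z ∈ Ici a := hy.trans hyz.le
  rw [Real.norm_of_nonneg (hf.1 z hz), Real.norm_of_nonneg (Real.exp_nonneg _)]
  calc f z ≤ q ^ ((z - x) / (y - x)) * f x :=
        hf.le_rpow_mul_of_le_mul hx hz hxy hyz hfx hq0.le ((div_lt_iff₀ hfx).1 hq).le
    _ = Real.exp (c * x + -c * z) * f x := by
        rw [Real.rpow_def_of_pos hq0, hc]
        ring_nf
    _ = Real.exp (c * x) * f x * Real.exp (-c * z) := by
        rw [Real.exp_add]
        ring

theorem exists_integrableOn_exp_mul {a : ℝ} (hf : LogConcaveFunOn (Ici a) f)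
    (hint : IntegrableOn f (Ici a)) :
    ∃ c > 0, ∀ t < c, IntegrableOn (fun x => Real.exp (t * x) * f x) (Ici a) := by
  obtain ⟨c, hc, hO⟩ := hf.exists_isBigO_exp_neg hint
  refine ⟨c, hc, fun t ht => ?_⟩
  have hloc : LocallyIntegrableOn (fun x => Real.exp (t * x) * f x) (Ici a) :=
    hint.locallyIntegrableOn.continuousOn_mul (by fun_prop) isClosed_Ici.isLocallyClosed
  have hdecay : (fun x => Real.exp (t * x) * f x) =O[atTop] fun x => Real.exp ((t - c) * x) := by
    refine ((isBigO_refl (fun x => Real.exp (t * x)) atTop).mul hO).congr_right fun x => ?_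
    rw [← Real.exp_add]
    ring_nf
  exact hloc.integrableOn_of_isBigO_atTop hdecay
    ⟨Ioi 0, Ioi_mem_atTop 0, integrableOn_exp_mul_Ioi (sub_neg.2 ht) 0⟩

end LogConcaveFunOn

namespace IsLogConcaveMeasure

variable {μ : Measure ℝ}

theorem eq_dirac_or_eq_withDensity (hμ : IsLogConcaveMeasure μ) :
    (∃ (c : ℝ≥0) (x₀ : ℝ), 0 ≤ x₀ ∧ μ = c • Measure.dirac x₀) ∨
    ∃ f : ℝ → ℝ, LogConcaveFunOn univ f ∧ f.support ⊆ Ici 0 ∧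
      μ = volume.withDensity fun x => ENNReal.ofReal (f x) := by
  refine hμ.imp_right ?_
  rintro ⟨f, hf, rfl⟩
  refine ⟨(Ici 0).indicator f, hf.indicator (convex_Ici 0), support_indicator_subset, ?_⟩
  rw [← withDensity_indicator measurableSet_Ici]
  congr with x
  by_cases hx : x ∈ Ici 0 <;> simp [hx]

theorem ae_nonneg (hμ : IsLogConcaveMeasure μ) : ∀ᵐ x ∂μ, 0 ≤ x := by
  obtain ⟨c, x₀, hx₀, rfl⟩ | ⟨f, -, rfl⟩ := hμ
  · exact Measure.ae_smul_measure (by simpa [ae_dirac_iff measurableSet_Ici] using hx₀) c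
  · exact (withDensity_absolutelyContinuous _ _).ae_le (ae_restrict_mem measurableSet_Ici)

theorem zero_mem_interior_integrableExpSet [IsFiniteMeasure μ] (hμ : IsLogConcaveMeasure μ) :
    0 ∈ interior (integrableExpSet id μ) := by
  obtain ⟨c, x₀, -, rfl⟩ | ⟨f, hf, hsupp, rfl⟩ := hμ.eq_dirac_or_eq_withDensity
  · have huniv : integrableExpSet id (c • Measure.dirac x₀) = univ := eq_univ_of_forall fun t =>
      (integrable_dirac (f := fun x => Real.exp (t * id x)) (by simp)).smul_measure_nnreal
    simp [huniv]
  · have hf0 : ∀ x, 0 ≤ f x := fun x => hf.1 x (mem_univ x)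
    have hint : Integrable f := by
      refine (lintegral_ofReal_ne_top_iff_integrable hf.measurable.aestronglyMeasurable
        (.of_forall hf0)).1 ?_
      simpa [withDensity_apply] using
        measure_ne_top (volume.withDensity fun x => ENNReal.ofReal (f x)) univ
    obtain ⟨c, hc, hexp⟩ :=
      (hf.mono (subset_univ (Ici 0))).exists_integrableOn_exp_mul hint.integrableOn
    refine mem_interior.2 ⟨Iio c, fun t ht => ?_, isOpen_Iio, hc⟩
    have hint_exp : Integrable fun x => Real.exp (t * x) * f x :=
      (integrableOn_iff_integrable_of_support_subset
        ((Function.support_mul_subset_right _ _).trans hsupp)).1 (hexp t ht)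
    refine (integrable_withDensity_iff_integrable_smul' hf.measurable.ennreal_ofReal
      (.of_forall fun _ => ENNReal.ofReal_lt_top)).2 ?_
    simpa only [ENNReal.toReal_ofReal (hf0 _), smul_eq_mul, mul_comm, id] using hint_exp

theorem memLp_id [IsFiniteMeasure μ] (hμ : IsLogConcaveMeasure μ) (j : ℕ) : MemLp id j μ := by
  exact_mod_cast memLp_of_mem_interior_integrableExpSet hμ.zero_mem_interior_integrableExpSet j

end IsLogConcaveMeasure

/-! ### Divided powers -/

/-- The divided power `x ^ j / j!`, the weight in `taylorCoeff`. -/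
noncomputable def dividedPow (j : ℕ) (x : ℝ) : ℝ := x ^ j / j.factorial

theorem dividedPow_nonneg (j : ℕ) {x : ℝ} (hx : 0 ≤ x) : 0 ≤ dividedPow j x := by
  unfold dividedPow
  positivity

@[fun_prop]
theorem continuous_dividedPow (j : ℕ) : Continuous (dividedPow j) := by
  unfold dividedPow
  fun_prop

theorem hasDerivAt_dividedPow_succ (j : ℕ) (x : ℝ) :
    HasDerivAt (dividedPow (j + 1)) (dividedPow j x) x := by
  refine ((hasDerivAt_pow (j + 1) x).div_const _).congr_deriv ?_
  rw [dividedPow, Nat.factorial_succ, Nat.cast_mul, add_tsub_cancel_right,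
    mul_div_mul_left _ _ (Nat.cast_ne_zero.2 j.succ_ne_zero)]

theorem dividedPow_succ (j : ℕ) (x : ℝ) :
    dividedPow (j + 1) x = x / (j + 1) * dividedPow j x := by
  simp only [dividedPow, pow_succ', Nat.factorial_succ, Nat.cast_mul, Nat.cast_succ,
    mul_div_mul_comm]

theorem dividedPow_mul_dividedPow_le {i j : ℕ} (hij : i ≤ j) {x y : ℝ} (hx : 0 ≤ x)
    (hxy : x ≤ y) : dividedPow j x * dividedPow i y ≤ dividedPow i x * dividedPow j y := by
  obtain ⟨d, rfl⟩ := Nat.exists_eq_add_of_le hij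
  have hpow : x ^ (i + d) * y ^ i ≤ x ^ i * y ^ (i + d) := by
    have hy := hx.trans hxy
    calc x ^ (i + d) * y ^ i = x ^ i * y ^ i * x ^ d := by ring
      _ ≤ x ^ i * y ^ i * y ^ d := by gcongr
      _ = x ^ i * y ^ (i + d) := by ring
  simp only [dividedPow, div_mul_div_comm]
  rw [mul_comm (i.factorial : ℝ)]
  gcongr

theorem dividedPow_mul_dividedPow_succ_le {i j : ℕ} (hij : i ≤ j) {x : ℝ} (hx : 0 ≤ x) :
    dividedPow i x * dividedPow (j + 1) x ≤ dividedPow (i + 1) x * dividedPow j x := by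
  have hi := dividedPow_nonneg i hx
  have hj := dividedPow_nonneg j hx
  calc dividedPow i x * dividedPow (j + 1) x
      = x / (j + 1) * (dividedPow i x * dividedPow j x) := by rw [dividedPow_succ]; ring
    _ ≤ x / (i + 1) * (dividedPow i x * dividedPow j x) := by gcongr
    _ = dividedPow (i + 1) x * dividedPow j x := by rw [dividedPow_succ]; ring

theorem integral_dividedPow_mul_dividedPow_le {i j : ℕ} (hij : i ≤ j) {c s : ℝ} (hc : 0 ≤ c)
    (hcs : c ≤ s - c) :
    ∫ x in c..(s - c), dividedPow i x * dividedPow (j + 1) (s - x) ≤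
      ∫ x in c..(s - c), dividedPow (i + 1) x * dividedPow j (s - x) := by
  have hderiv : ∀ x, HasDerivAt (fun x => dividedPow (i + 1) x * dividedPow (j + 1) (s - x))
      (dividedPow i x * dividedPow (j + 1) (s - x) - dividedPow (i + 1) x * dividedPow j (s - x))
      x := fun x =>
    ((hasDerivAt_dividedPow_succ i x).mul
      ((hasDerivAt_dividedPow_succ j (s - x)).comp_const_sub s x)).congr_deriv (by ring)
  have hftc := intervalIntegral.integral_eq_sub_of_hasDerivAt (a := c) (b := s - c)
    (fun x _ => hderiv x) (Continuous.intervalIntegrable (by fun_prop) _ _)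
  rw [intervalIntegral.integral_sub (Continuous.intervalIntegrable (by fun_prop) _ _)
    (Continuous.intervalIntegrable (by fun_prop) _ _), sub_sub_cancel] at hftc
  have hboundary : dividedPow (i + 1) (s - c) * dividedPow (j + 1) c ≤
      dividedPow (i + 1) c * dividedPow (j + 1) (s - c) := by
    rw [mul_comm]
    exact dividedPow_mul_dividedPow_le (Nat.succ_le_succ hij) hc hcs
  linarith

theorem ae_eq_Icc_of_symmetric_of_filled {E : Set ℝ} {s : ℝ} (hne : E.Nonempty)
    (hbdd : BddBelow E) (hsymm : ∀ x ∈ E, s - x ∈ E) (hfill : ∀ x ∈ E, Icc x (s - x) ⊆ E) :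
    E =ᵐ[volume] Icc (sInf E) (s - sInf E) := by
  have hsub : E ⊆ Icc (sInf E) (s - sInf E) := fun x hx =>
    ⟨csInf_le hbdd hx, by linarith [csInf_le hbdd (hsymm x hx)]⟩
  have hsup : Ioo (sInf E) (s - sInf E) ⊆ E := by
    intro x hx
    obtain ⟨y, hy, hyx⟩ := exists_lt_of_csInf_lt hne (lt_min hx.1 (lt_sub_comm.1 hx.2))
    exact hfill y hy ⟨(hyx.trans_le (min_le_left _ _)).le,
      (lt_sub_comm.1 (hyx.trans_le (min_le_right _ _))).le⟩
  exact hsub.eventuallyLE.antisymm (Ioo_ae_eq_Icc.symm.le.trans hsup.eventuallyLE)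

theorem setLIntegral_dividedPow_mul_dividedPow_le {i j : ℕ} (hij : i ≤ j) {E : Set ℝ} {s : ℝ}
    (hpos : E ⊆ Ici 0) (hsymm : ∀ x ∈ E, s - x ∈ E) (hfill : ∀ x ∈ E, Icc x (s - x) ⊆ E) :
    ∫⁻ x in E, ENNReal.ofReal (dividedPow i x) * ENNReal.ofReal (dividedPow (j + 1) (s - x)) ≤
      ∫⁻ x in E, ENNReal.ofReal (dividedPow (i + 1) x) * ENNReal.ofReal (dividedPow j (s - x)) := by
  obtain rfl | hne := E.eq_empty_or_nonempty
  · simp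
  have hbdd : BddBelow E := ⟨0, fun x hx => hpos hx⟩
  have hc : 0 ≤ sInf E := le_csInf hne fun x hx => hpos hx
  have hcs : sInf E ≤ s - sInf E := by
    obtain ⟨x, hx⟩ := hne
    linarith [csInf_le hbdd hx, csInf_le hbdd (hsymm x hx)]
  have hlintegral : ∀ p q : ℕ,
      ∫⁻ x in E, ENNReal.ofReal (dividedPow p x) * ENNReal.ofReal (dividedPow q (s - x)) =
        ENNReal.ofReal (∫ x in sInf E..(s - sInf E), dividedPow p x * dividedPow q (s - x)) := by
    intro p q
    have hmem : ∀ x ∈ Icc (sInf E) (s - sInf E), 0 ≤ x ∧ 0 ≤ s - x := fun x hx =>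
      ⟨hc.trans hx.1, by linarith [hx.2]⟩
    rw [setLIntegral_congr (ae_eq_Icc_of_symmetric_of_filled hne hbdd hsymm hfill),
      intervalIntegral.integral_of_le hcs, ← integral_Icc_eq_integral_Ioc,
      ofReal_integral_eq_lintegral_ofReal (Continuous.integrableOn_Icc (by fun_prop)) ?_]
    · refine setLIntegral_congr_fun measurableSet_Icc fun x hx => ?_
      exact (ENNReal.ofReal_mul (dividedPow_nonneg p (hmem x hx).1)).symm
    · filter_upwards [ae_restrict_mem measurableSet_Icc] with x hx
      exact mul_nonneg (dividedPow_nonneg p (hmem x hx).1) (dividedPow_nonneg q (hmem x hx).2)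
  rw [hlintegral, hlintegral]
  exact ENNReal.ofReal_le_ofReal (integral_dividedPow_mul_dividedPow_le hij hc hcs)

theorem lintegral_mul_ofReal_le_of_setLIntegral_superlevel_le {α : Type*} [MeasurableSpace α]
    {μ : Measure α} {u v : α → ℝ≥0∞} {g : α → ℝ} (hu : Measurable u) (hv : Measurable v)
    (hg : Measurable g) (hg0 : 0 ≤ g)
    (hle : ∀ τ > 0, ∫⁻ x in {x | τ ≤ g x}, u x ∂μ ≤ ∫⁻ x in {x | τ ≤ g x}, v x ∂μ) :
    ∫⁻ x, u x * ENNReal.ofReal (g x) ∂μ ≤ ∫⁻ x, v x * ENNReal.ofReal (g x) ∂μ := by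
  have hlayer : ∀ {w : α → ℝ≥0∞}, Measurable w → ∫⁻ x, w x * ENNReal.ofReal (g x) ∂μ =
      ∫⁻ τ in Ioi 0, ∫⁻ x in {x | τ ≤ g x}, w x ∂μ := by
    intro w hw
    calc ∫⁻ x, w x * ENNReal.ofReal (g x) ∂μ
        = ∫⁻ x, ENNReal.ofReal (g x) ∂(μ.withDensity w) :=
          (lintegral_withDensity_eq_lintegral_mul μ hw hg.ennreal_ofReal).symm
      _ = ∫⁻ τ in Ioi 0, μ.withDensity w {x | τ ≤ g x} :=
          lintegral_eq_lintegral_meas_le _ (.of_forall hg0) hg.aemeasurable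
      _ = ∫⁻ τ in Ioi 0, ∫⁻ x in {x | τ ≤ g x}, w x ∂μ :=
          lintegral_congr fun τ => withDensity_apply _ (measurableSet_le measurable_const hg)
  rw [hlayer hu, hlayer hv]
  exact setLIntegral_mono' measurableSet_Ioi hle

theorem LogConcaveFunOn.lintegral_dividedPow_mul_dividedPow_le {f : ℝ → ℝ}
    (hf : LogConcaveFunOn univ f) (hsupp : f.support ⊆ Ici 0) {i j : ℕ} (hij : i ≤ j) (s : ℝ) :
    ∫⁻ x, ENNReal.ofReal (dividedPow i x) * ENNReal.ofReal (dividedPow (j + 1) (s - x)) *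
        ENNReal.ofReal (f x * f (s - x)) ≤
      ∫⁻ x, ENNReal.ofReal (dividedPow (i + 1) x) * ENNReal.ofReal (dividedPow j (s - x)) *
        ENNReal.ofReal (f x * f (s - x)) := by
  have hmeas := hf.measurable
  refine lintegral_mul_ofReal_le_of_setLIntegral_superlevel_le (by fun_prop) (by fun_prop)
    (by fun_prop) (fun x => mul_nonneg (hf.1 x (mem_univ x)) (hf.1 _ (mem_univ _)))
    fun τ hτ => setLIntegral_dividedPow_mul_dividedPow_le hij ?_ ?_ ?_
  · exact fun x hx => hsupp (left_ne_zero_of_mul (hτ.trans_le hx).ne')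
  · intro x hx
    simpa only [mem_ofPred_eq, sub_sub_cancel, mul_comm] using hx
  · intro x hx y hy
    have h := hf.mul_le_mul_of_mem_Icc (mem_univ x) (mem_univ (s - x)) hy
    rw [add_sub_cancel] at h
    exact hx.trans h

/-! ### Moment measures -/

/-- The measure `x ^ j / j! dμ(x)`, whose total mass is the `j`-th moment of `μ` over `j!`.
The negative values taken by the density on `(-∞, 0)` for odd `j` are truncated to `0`. -/
noncomputable def momentMeasure (μ : Measure ℝ) (j : ℕ) : Measure ℝ :=
  μ.withDensity fun x => ENNReal.ofReal (dividedPow j x)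

theorem momentMeasure_smul_dirac (c : ℝ≥0) (x₀ : ℝ) (j : ℕ) :
    momentMeasure (c • Measure.dirac x₀) j =
      (c * ENNReal.ofReal (dividedPow j x₀)) • Measure.dirac x₀ := by
  change ((c : ℝ≥0∞) • Measure.dirac x₀).withDensity _ = _
  rw [withDensity_smul_measure, dirac_withDensity, smul_smul]

theorem momentMeasure_smul_dirac_conv (c : ℝ≥0) {x₀ : ℝ} (hx₀ : 0 ≤ x₀) (i j : ℕ) :
    momentMeasure (c • Measure.dirac x₀) i ∗ momentMeasure (c • Measure.dirac x₀) j =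
      (c ^ 2 * ENNReal.ofReal (dividedPow i x₀ * dividedPow j x₀)) • Measure.dirac (x₀ + x₀) := by
  simp only [momentMeasure_smul_dirac, Measure.conv_smul_left, Measure.conv_smul_right,
    Measure.dirac_conv_dirac, smul_smul]
  rw [mul_mul_mul_comm, ← sq, ← ENNReal.ofReal_mul (dividedPow_nonneg j hx₀),
    mul_comm (dividedPow j x₀)]

theorem momentMeasure_withDensity_conv {f : ℝ → ℝ} (hf : Measurable f) (hf0 : 0 ≤ f) (i j : ℕ) :
    momentMeasure (volume.withDensity fun x => ENNReal.ofReal (f x)) i ∗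
        momentMeasure (volume.withDensity fun x => ENNReal.ofReal (f x)) j =
      volume.withDensity fun s =>
        ∫⁻ x, ENNReal.ofReal (dividedPow i x) * ENNReal.ofReal (dividedPow j (s - x)) *
          ENNReal.ofReal (f x * f (s - x)) := by
  have hdens : ∀ p, Measurable fun x => ENNReal.ofReal (dividedPow p x) := by fun_prop
  simp only [momentMeasure, ← withDensity_mul _ hf.ennreal_ofReal (hdens _)]
  rw [conv_withDensity_eq_lconvolution (hf.ennreal_ofReal.mul (hdens i))
    (hf.ennreal_ofReal.mul (hdens j))]
  congr with s
  rw [lconvolution_def]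
  refine lintegral_congr fun x => ?_
  rw [ENNReal.ofReal_mul (hf0 x), Pi.mul_apply, Pi.mul_apply, neg_add_eq_sub]
  ring

theorem LogConcaveFunOn.conv_momentMeasure_succ_le {f : ℝ → ℝ} (hf : LogConcaveFunOn univ f)
    (hsupp : f.support ⊆ Ici 0) {i j : ℕ} (hij : i ≤ j) :
    momentMeasure (volume.withDensity fun x => ENNReal.ofReal (f x)) i ∗
        momentMeasure (volume.withDensity fun x => ENNReal.ofReal (f x)) (j + 1) ≤
      momentMeasure (volume.withDensity fun x => ENNReal.ofReal (f x)) (i + 1) ∗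
        momentMeasure (volume.withDensity fun x => ENNReal.ofReal (f x)) j := by
  have hf0 : 0 ≤ f := fun x => hf.1 x (mem_univ x)
  rw [momentMeasure_withDensity_conv hf.measurable hf0,
    momentMeasure_withDensity_conv hf.measurable hf0]
  exact withDensity_mono (.of_forall (hf.lintegral_dividedPow_mul_dividedPow_le hsupp hij))

namespace IsLogConcaveMeasure

variable {μ : Measure ℝ}

theorem conv_momentMeasure_succ_le (hμ : IsLogConcaveMeasure μ) {i j : ℕ} (hij : i ≤ j) :
    momentMeasure μ i ∗ momentMeasure μ (j + 1) ≤ momentMeasure μ (i + 1) ∗ momentMeasure μ j := by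
  obtain ⟨c, x₀, hx₀, rfl⟩ | ⟨f, hf, hsupp, rfl⟩ := hμ.eq_dirac_or_eq_withDensity
  · rw [momentMeasure_smul_dirac_conv c hx₀, momentMeasure_smul_dirac_conv c hx₀]
    gcongr (_ * ENNReal.ofReal ?_) • _
    exact dividedPow_mul_dividedPow_succ_le hij hx₀
  · exact hf.conv_momentMeasure_succ_le hsupp hij

theorem conv_momentMeasure_le (hμ : IsLogConcaveMeasure μ) {k l m n : ℕ} (hkl : k ≤ l)
    (hlm : l ≤ m) (hsum : k + n = l + m) :
    momentMeasure μ k ∗ momentMeasure μ n ≤ momentMeasure μ l ∗ momentMeasure μ m := by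
  induction l, hkl using Nat.le_induction generalizing m with
  | base => rw [Nat.add_left_cancel hsum]
  | succ l _ ih =>
    exact (ih (m := m + 1) (by omega) (by omega)).trans
      (hμ.conv_momentMeasure_succ_le (Nat.le_of_succ_le hlm))

end IsLogConcaveMeasure

/-! ### Integrals against convolutions and moment measures -/

theorem ae_nonneg_iff_measure_Iio_eq_zero {μ : Measure ℝ} :
    (∀ᵐ x ∂μ, 0 ≤ x) ↔ μ (Iio 0) = 0 := by
  simp only [ae_iff, not_le, Iio]

theorem ae_nonneg_conv {α β : Measure ℝ} (hα : ∀ᵐ x ∂α, 0 ≤ x) (hβ : ∀ᵐ x ∂β, 0 ≤ x) :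
    ∀ᵐ x ∂(α ∗ β), 0 ≤ x := by
  refine (ae_map_iff (by fun_prop) measurableSet_Ici).2 ?_
  filter_upwards [Measure.quasiMeasurePreserving_fst.ae hα,
    Measure.quasiMeasurePreserving_snd.ae hβ] with p h₁ h₂
  exact add_nonneg h₁ h₂

theorem integrable_conv_of_map_add {M 𝕜 : Type*} [AddMonoid M] [MeasurableSpace M]
    [MeasurableAdd₂ M] [RCLike 𝕜] {α β : Measure M} {φ : M → 𝕜}
    (hφ : StronglyMeasurable φ) (hadd : ∀ x y, φ (x + y) = φ x * φ y) (hα : Integrable φ α)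
    (hβ : Integrable φ β) : Integrable φ (α ∗ β) := by
  rw [Measure.conv, integrable_map_measure hφ.aestronglyMeasurable (by fun_prop)]
  simpa only [Function.comp_def, hadd] using hα.mul_prod hβ

theorem integral_conv_of_map_add {M 𝕜 : Type*} [AddMonoid M] [MeasurableSpace M]
    [MeasurableAdd₂ M] [RCLike 𝕜] {α β : Measure M} [SFinite α] [SFinite β] {φ : M → 𝕜}
    (hφ : StronglyMeasurable φ) (hadd : ∀ x y, φ (x + y) = φ x * φ y) :
    ∫ x, φ x ∂(α ∗ β) = (∫ x, φ x ∂α) * ∫ x, φ x ∂β := by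
  rw [Measure.conv, integral_map (by fun_prop) hφ.aestronglyMeasurable]
  simp only [hadd]
  exact integral_prod_mul φ φ

theorem integral_measure_sub {α E : Type*} [MeasurableSpace α] [NormedAddCommGroup E]
    [NormedSpace ℝ E] {μ ν : Measure α} [IsFiniteMeasure ν] (hle : ν ≤ μ) {φ : α → E}
    (hφ : Integrable φ μ) : ∫ x, φ x ∂(μ - ν) = ∫ x, φ x ∂μ - ∫ x, φ x ∂ν := by
  rw [eq_sub_iff_add_eq, ← integral_add_measure (hφ.mono_measure Measure.sub_le)
    (hφ.mono_measure hle), Measure.sub_add_cancel_of_le hle]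

theorem integrable_exp_neg_mul_of_ae_nonneg {μ : Measure ℝ} [IsFiniteMeasure μ]
    (hμ : ∀ᵐ x ∂μ, 0 ≤ x) {t : ℝ} (ht : 0 ≤ t) : Integrable (fun x => Real.exp (-(t * x))) μ := by
  refine Integrable.of_bound (C := 1) (by fun_prop) ?_
  filter_upwards [hμ] with x hx
  rw [Real.norm_of_nonneg (Real.exp_nonneg _), Real.exp_le_one_iff]
  exact neg_nonpos.2 (mul_nonneg ht hx)

section MomentMeasure

variable {μ : Measure ℝ}

theorem isFiniteMeasure_momentMeasure [IsFiniteMeasure μ] {j : ℕ} (hmom : MemLp id j μ) :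
    IsFiniteMeasure (momentMeasure μ j) := by
  have hpow : Integrable (fun x : ℝ => x ^ j) μ := by
    refine (integrable_norm_iff (by fun_prop)).1 ?_
    simpa only [id, norm_pow] using hmom.integrable_norm_pow'
  exact isFiniteMeasure_withDensity_ofReal (hpow.div_const _).2

theorem ae_nonneg_momentMeasure (hμ : ∀ᵐ x ∂μ, 0 ≤ x) (j : ℕ) :
    ∀ᵐ x ∂momentMeasure μ j, 0 ≤ x :=
  (withDensity_absolutelyContinuous _ _).ae_le hμ

theorem integral_momentMeasure (hμ : ∀ᵐ x ∂μ, 0 ≤ x) (j : ℕ) {E : Type*} [NormedAddCommGroup E]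
    [NormedSpace ℝ E] (φ : ℝ → E) :
    ∫ x, φ x ∂(momentMeasure μ j) = ∫ x, dividedPow j x • φ x ∂μ := by
  rw [momentMeasure, integral_withDensity_eq_integral_toReal_smul (by fun_prop)
    (.of_forall fun _ => ENNReal.ofReal_lt_top)]
  refine integral_congr_ae ?_
  filter_upwards [hμ] with x hx
  rw [ENNReal.toReal_ofReal (dividedPow_nonneg j hx)]

theorem taylorCoeff_eq_integral_momentMeasure (hμ : ∀ᵐ x ∂μ, 0 ≤ x) (t : ℝ) (j : ℕ) :
    taylorCoeff μ t j = ∫ x, Real.exp (-(t * x)) ∂(momentMeasure μ j) :=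
  (integral_momentMeasure hμ j _).symm

theorem fourierMeasure_eq_charFun (μ : Measure ℝ) :
    fourierMeasure μ = fun t => charFun μ (-t) := by
  ext t
  rw [fourierMeasure, charFun_apply_real]
  congr! 3 with x
  push_cast
  ring

variable [IsFiniteMeasure μ]

theorem contDiff_fourierMeasure (hmom : ∀ j : ℕ, MemLp id j μ) :
    ContDiff ℝ (⊤ : ℕ∞) (fourierMeasure μ) := by
  rw [fourierMeasure_eq_charFun]
  exact (contDiff_charFun' hmom).comp contDiff_neg

theorem iteratedDeriv_fourierMeasure (hμ : ∀ᵐ x ∂μ, 0 ≤ x) {j : ℕ} (hmom : MemLp id j μ) (t : ℝ) :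
    iteratedDeriv j (fourierMeasure μ) t / (j.factorial : ℂ) =
      (-Complex.I) ^ j * fourierMeasure (momentMeasure μ j) t := by
  have hexp : ∀ x : ℝ, dividedPow j x • Complex.exp (-(Complex.I * t * x)) =
      (x : ℂ) ^ j * Complex.exp ((-t : ℝ) * x * Complex.I) / j.factorial := by
    intro x
    rw [dividedPow, Complex.real_smul, show -(Complex.I * t * x) = (-t : ℝ) * x * Complex.I by
      push_cast; ring]
    push_cast
    ring
  rw [fourierMeasure_eq_charFun μ, iteratedDeriv_comp_neg, iteratedDeriv_charFun hmom,
    fourierMeasure, integral_momentMeasure hμ]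
  simp only [hexp]
  rw [integral_div, neg_pow Complex.I, Complex.real_smul]
  push_cast
  ring

end MomentMeasure

/-- The Berwald–Borell transform of `μ` as the difference of two convolutions. The subtraction of
measures is truncated: this is the intended measure only if `momentMeasure μ k ∗ momentMeasure μ n`
is dominated by `momentMeasure μ l ∗ momentMeasure μ m`. -/
noncomputable def berwaldBorellMeasure (μ : Measure ℝ) (k l m n : ℕ) : Measure ℝ :=
  momentMeasure μ l ∗ momentMeasure μ m - momentMeasure μ k ∗ momentMeasure μ n

section BerwaldBorellMeasure

variable {μ : Measure ℝ} [IsFiniteMeasure μ] {k l m n : ℕ}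

theorem integral_berwaldBorellMeasure (hmom : ∀ j : ℕ, MemLp id j μ)
    (hle : momentMeasure μ k ∗ momentMeasure μ n ≤ momentMeasure μ l ∗ momentMeasure μ m)
    {𝕜 : Type*} [RCLike 𝕜] {φ : ℝ → 𝕜} (hφ : StronglyMeasurable φ)
    (hadd : ∀ x y, φ (x + y) = φ x * φ y) (hint : ∀ j, Integrable φ (momentMeasure μ j)) :
    ∫ x, φ x ∂(berwaldBorellMeasure μ k l m n) =
      (∫ x, φ x ∂(momentMeasure μ l)) * ∫ x, φ x ∂(momentMeasure μ m) -
        (∫ x, φ x ∂(momentMeasure μ k)) * ∫ x, φ x ∂(momentMeasure μ n) := by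
  have hfin : ∀ j, IsFiniteMeasure (momentMeasure μ j) := fun j =>
    isFiniteMeasure_momentMeasure (hmom j)
  rw [berwaldBorellMeasure, integral_measure_sub hle
    (integrable_conv_of_map_add hφ hadd (hint l) (hint m)), integral_conv_of_map_add hφ hadd,
    integral_conv_of_map_add hφ hadd]

theorem isBerwaldBorellTransform_berwaldBorellMeasure (hμ : ∀ᵐ x ∂μ, 0 ≤ x)
    (hmom : ∀ j : ℕ, MemLp id j μ)
    (hle : momentMeasure μ k ∗ momentMeasure μ n ≤ momentMeasure μ l ∗ momentMeasure μ m) :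
    IsBerwaldBorellTransform μ k l m n (berwaldBorellMeasure μ k l m n) := by
  have hfin : ∀ j, IsFiniteMeasure (momentMeasure μ j) := fun j =>
    isFiniteMeasure_momentMeasure (hmom j)
  have hnonneg := ae_nonneg_momentMeasure hμ
  refine ⟨isFiniteMeasure_of_le _ Measure.sub_le, ?_, fun t ht => ?_⟩
  · exact Measure.absolutelyContinuous_of_le Measure.sub_le
      (ae_nonneg_iff_measure_Iio_eq_zero.1 (ae_nonneg_conv (hnonneg l) (hnonneg m)))
  · simp only [taylorCoeff_eq_integral_momentMeasure hμ]
    refine integral_berwaldBorellMeasure hmom hle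
      (Continuous.stronglyMeasurable (by fun_prop)) (fun x y => ?_)
      fun j => integrable_exp_neg_mul_of_ae_nonneg (hnonneg j) ht.le
    rw [← Real.exp_add]
    ring_nf

theorem iteratedDeriv_fourierMeasure_mul_sub_mul (hμ : ∀ᵐ x ∂μ, 0 ≤ x)
    (hmom : ∀ j : ℕ, MemLp id j μ) (hsum : k + n = l + m)
    (hle : momentMeasure μ k ∗ momentMeasure μ n ≤ momentMeasure μ l ∗ momentMeasure μ m)
    (t : ℝ) :
    iteratedDeriv l (fourierMeasure μ) t / (l.factorial : ℂ) *
          (iteratedDeriv m (fourierMeasure μ) t / (m.factorial : ℂ)) -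
        iteratedDeriv k (fourierMeasure μ) t / (k.factorial : ℂ) *
          (iteratedDeriv n (fourierMeasure μ) t / (n.factorial : ℂ)) =
      (-Complex.I) ^ (l + m) * fourierMeasure (berwaldBorellMeasure μ k l m n) t := by
  have hfin : ∀ j, IsFiniteMeasure (momentMeasure μ j) := fun j =>
    isFiniteMeasure_momentMeasure (hmom j)
  have hfourier : fourierMeasure (berwaldBorellMeasure μ k l m n) t =
      fourierMeasure (momentMeasure μ l) t * fourierMeasure (momentMeasure μ m) t -
        fourierMeasure (momentMeasure μ k) t * fourierMeasure (momentMeasure μ n) t := by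
    refine integral_berwaldBorellMeasure hmom hle
      (Continuous.stronglyMeasurable (by fun_prop)) (fun x y => ?_)
      fun j => Integrable.of_bound (C := 1) (by fun_prop) (.of_forall fun x => ?_)
    · rw [← Complex.exp_add]
      push_cast
      ring_nf
    · simp [Complex.norm_exp]
  simp only [iteratedDeriv_fourierMeasure hμ (hmom _)]
  rw [hfourier, mul_mul_mul_comm, mul_mul_mul_comm ((-Complex.I) ^ k), ← pow_add, ← pow_add, hsum,
    mul_sub]

end BerwaldBorellMeasure

/-! ### Laplace uniqueness and the Berwald–Borell transform -/

theorem Iic_zero_subset_integrableExpSet {μ : Measure ℝ} [IsFiniteMeasure μ]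
    (hμ : ∀ᵐ x ∂μ, 0 ≤ x) : Iic 0 ⊆ integrableExpSet id μ := fun t ht => by
  simpa only [neg_mul, neg_neg, integrableExpSet, mem_ofPred_eq, id] using
    integrable_exp_neg_mul_of_ae_nonneg hμ (neg_nonneg.2 ht)

theorem tendsto_complexMGF_charFun {μ : Measure ℝ} [IsFiniteMeasure μ] (hμ : ∀ᵐ x ∂μ, 0 ≤ x)
    (t : ℝ) : Tendsto (fun r : ℝ => complexMGF id μ (r + t * Complex.I)) (𝓝[<] 0)
      (𝓝 (charFun μ t)) := by
  rw [← complexMGF_id_mul_I]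
  refine tendsto_integral_filter_of_dominated_convergence (fun _ => 1)
    (.of_forall fun r => by fun_prop) ?_ (integrable_const _) (.of_forall fun x => ?_)
  · filter_upwards [self_mem_nhdsWithin] with r hr
    filter_upwards [hμ] with x hx
    rw [Complex.norm_exp]
    simpa using mul_nonpos_of_nonpos_of_nonneg (le_of_lt hr) hx
  · have hcont : Continuous fun r : ℝ => Complex.exp ((r + t * Complex.I) * (id x : ℝ)) := by
      fun_prop
    simpa using (hcont.tendsto 0).mono_left nhdsWithin_le_nhds

theorem eqOn_re_neg_of_eqOn_ofReal_neg {f g : ℂ → ℂ} (hf : AnalyticOnNhd ℂ f {z | z.re < 0})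
    (hg : AnalyticOnNhd ℂ g {z | z.re < 0}) (h : ∀ r : ℝ, r < 0 → f r = g r) :
    EqOn f g {z | z.re < 0} := by
  refine hf.eqOn_of_preconnected_of_frequently_eq hg (convex_halfSpace_re_lt 0).isPreconnected
    (z₀ := ((-1 : ℝ) : ℂ)) (by simp) ?_
  have hreal : ∃ᶠ r : ℝ in 𝓝[≠] (-1), f r = g r := by
    refine Eventually.frequently ?_
    filter_upwards [nhdsWithin_le_nhds (Iio_mem_nhds neg_one_lt_zero)] with r hr using h r hr
  refine Tendsto.frequently (tendsto_nhdsWithin_iff.2 ⟨?_, ?_⟩) hreal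
  · exact (Complex.continuous_ofReal.tendsto _).mono_left nhdsWithin_le_nhds
  · filter_upwards [self_mem_nhdsWithin] with r hr
    exact Complex.ofReal_injective.ne hr

theorem measure_eq_of_laplace_eq {μ ν : Measure ℝ} [IsFiniteMeasure μ] [IsFiniteMeasure ν]
    (hμ : ∀ᵐ x ∂μ, 0 ≤ x) (hν : ∀ᵐ x ∂ν, 0 ≤ x)
    (h : ∀ t > 0, ∫ x, Real.exp (-(t * x)) ∂μ = ∫ x, Real.exp (-(t * x)) ∂ν) : μ = ν := by
  have hanalytic : ∀ {ρ : Measure ℝ} [IsFiniteMeasure ρ], (∀ᵐ x ∂ρ, 0 ≤ x) →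
      AnalyticOnNhd ℂ (complexMGF id ρ) {z | z.re < 0} := fun hρ z hz =>
    analyticAt_complexMGF (interior_mono (Iic_zero_subset_integrableExpSet hρ) (by simpa using hz))
  have hmgf : EqOn (complexMGF id μ) (complexMGF id ν) {z | z.re < 0} := by
    refine eqOn_re_neg_of_eqOn_ofReal_neg (hanalytic hμ) (hanalytic hν) fun r hr => ?_
    rw [complexMGF_ofReal, complexMGF_ofReal]
    simpa [mgf] using h (-r) (neg_pos.2 hr)
  refine Measure.ext_of_charFun (funext fun t => tendsto_nhds_unique
    (tendsto_complexMGF_charFun hμ t) ((tendsto_complexMGF_charFun hν t).congr' ?_))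
  filter_upwards [self_mem_nhdsWithin] with r hr
  exact (hmgf (by simpa using hr)).symm

theorem IsBerwaldBorellTransform.unique {μ ν ν' : Measure ℝ} {k l m n : ℕ}
    (hν : IsBerwaldBorellTransform μ k l m n ν) (hν' : IsBerwaldBorellTransform μ k l m n ν') :
    ν = ν' := by
  have := hν.finite
  have := hν'.finite
  exact measure_eq_of_laplace_eq (ae_nonneg_iff_measure_Iio_eq_zero.2 hν.neg_null)
    (ae_nonneg_iff_measure_Iio_eq_zero.2 hν'.neg_null) fun t ht => by
      rw [hν.laplace t ht, hν'.laplace t ht]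

theorem mainTheorem10 (μ : Measure ℝ) [IsFiniteMeasure μ] (hμ : IsLogConcaveMeasure μ)
    (k l m n : ℕ) (hkl : k ≤ l) (hlm : l ≤ m) (hmn : m ≤ n) (hsum : k + n = l + m) :
    ContDiff ℝ (⊤ : ℕ∞) (fourierMeasure μ) ∧
    ∃ ν : Measure ℝ, IsBerwaldBorellTransform μ k l m n ν ∧
      (∀ ν' : Measure ℝ, IsBerwaldBorellTransform μ k l m n ν' → ν' = ν) ∧
      ∀ t : ℝ,
        iteratedDeriv l (fourierMeasure μ) t / (l.factorial : ℂ) *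
            (iteratedDeriv m (fourierMeasure μ) t / (m.factorial : ℂ)) -
          iteratedDeriv k (fourierMeasure μ) t / (k.factorial : ℂ) *
            (iteratedDeriv n (fourierMeasure μ) t / (n.factorial : ℂ)) =
        (-Complex.I) ^ (l + m) * fourierMeasure ν t := by
  have hnonneg := hμ.ae_nonneg
  have hmom := hμ.memLp_id
  have hle := hμ.conv_momentMeasure_le hkl hlm hsum
  have hν := isBerwaldBorellTransform_berwaldBorellMeasure hnonneg hmom hle
  exact ⟨contDiff_fourierMeasure hmom, berwaldBorellMeasure μ k l m n, hν,
    fun ν' hν' => hν'.unique hν,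
    iteratedDeriv_fourierMeasure_mul_sub_mul hnonneg hmom hsum hle⟩
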